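/- Let $X$ be a complex Banach space that has a Schauder basis, and let $u\colon X\to\mathbb{R}$ be a locally bounded function, i.e. every point of $X$ has a neighbourhood on which $u$ is bounded. Then there is a continuous plurisubharmonic function $w\colon X\to\mathbb{R}$ such that $u(x)<w(x)$ for every $x\in X$. Here a continuous function $w\colon X\to\mathbb{R}$ is called plurisubharmonic if $$w(a)\le\frac1{2\pi}\int_0^{2\pi}w(a+e^{i\theta}b)\,d\theta\qquad\text{for all }a,b\in X.$$ -/

import Mathlib

/-- `u : X → ℝ` is locally bounded: every point has a neighbourhood on which `|u|` is bounded. -/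
def IsLocallyBounded {X : Type*} [TopologicalSpace X] (u : X → ℝ) : Prop :=
  ∀ x : X, ∃ V ∈ nhds x, ∃ C : ℝ, ∀ y ∈ V, |u y| ≤ C

/-- For an open subset `U` of a complex normed space, `psc U` is the family of real functions that
are continuous on the closure of `U` and plurisubharmonic on `U`. As usual, a continuous function
`w` is plurisubharmonic on `U` if `w a ≤ (2 * π)⁻¹ * ∫ θ in 0..2 * π, w (a + exp (i θ) • b)`
whenever the closed disc `{a + ζ • b : |ζ| ≤ 1}` is contained in `U`.
(Functions are total on `X`; only their values on the closure of `U` matter.) -/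
def psc {X : Type*} [NormedAddCommGroup X] [NormedSpace ℂ X] (U : Set X) : Set (X → ℝ) :=
  {w | ContinuousOn w (closure U) ∧
    ∀ a b : X, (∀ ζ : ℂ, ‖ζ‖ ≤ 1 → a + ζ • b ∈ U) →
      w a ≤ Real.circleAverage (fun ζ : ℂ => w (a + ζ • b)) 0 1}

/-!
The proof exhausts `X` by sets described through the tails of a Schauder basis and passes from
these sets to `X` by an infinite descent along a tree.

Let `T m = 1 - P m` be the tail projections of the basis. Call `u` dominated on a set `K`
(`IsDominatedOn`) if for every continuous plurisubharmonic `q` there is a continuous plurisubharmonic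
`w ≥ 0` with `u < w` on `K ∩ {q ≥ 0}` and `w = 0` on `{q < -τ}`, where
`τ x = 1 + log⁺ (D ‖x‖)` and `‖T m‖ ≤ D` for all `m`. If `u` is bounded above on `K`,
then a multiple of `max (q + 1) 0` is such a `w`.

* If `u` is dominated on `K ∩ {‖T m x‖ ≤ ε}` for all `m`, then it is dominated on `K`
  (`IsDominatedOn.of_forall_inter`). Given `q`, domination is applied to
  `q m = α q + max (log (‖T (m - 1) x‖ / ε)) (-log m)`. This is nonnegative where `q ≥ 0` and `m` is
  the first index with `‖T m x‖ ≤ ε`, and it tends to `-∞` locally uniformly as `m → ∞`, so the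
  resulting functions form a locally finite family and their sum dominates. That the gap `τ` is the
  same for all `q` and `K` is essential for this; the loss in the gap is absorbed by the factor `α`.
* Hence, if domination failed on a ball, it would fail on all members of a decreasing sequence
  `K j ⊆ {‖T (n j) x‖ ≤ 1 / j}`. Then `u` is unbounded on each `K j`; points `x j ∈ K j` with
  `u (x j) > j` form a totally bounded sequence, and `u` is unbounded near any of its cluster points
  (`SchauderBasis.isDominatedOn_closedBall`).
* The dominating functions for the spherical shells `n < ‖x‖ ≤ n + 1`, obtained with
  `q n = log⁺ ‖x‖ - log n`, are summed in the same way.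
-/

/-! ### Continuous plurisubharmonic functions -/

section Plurisubharmonic

variable {X : Type*} [NormedAddCommGroup X] [NormedSpace ℂ X]

/-- `w` is a continuous plurisubharmonic function on the whole space `X`. -/
structure IsContPsh (w : X → ℝ) : Prop where
  continuous : Continuous w
  le_circleAverage : ∀ a b : X, w a ≤ Real.circleAverage (fun ζ : ℂ => w (a + ζ • b)) 0 1

theorem IsContPsh.mem_psc {w : X → ℝ} (hw : IsContPsh w) : w ∈ psc (Set.univ : Set X) :=
  ⟨hw.continuous.continuousOn, fun a b _ => hw.le_circleAverage a b⟩

theorem Continuous.circleIntegrable_comp_line {w : X → ℝ} (hw : Continuous w) (a b : X) :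
    CircleIntegrable (fun ζ : ℂ => w (a + ζ • b)) 0 1 :=
  ContinuousOn.circleIntegrable' (by fun_prop)

theorem isContPsh_const (c : ℝ) : IsContPsh (fun _ : X => c) :=
  ⟨continuous_const, fun _ _ => by rw [Real.circleAverage_const]⟩

theorem IsContPsh.add {v w : X → ℝ} (hv : IsContPsh v) (hw : IsContPsh w) :
    IsContPsh (fun x => v x + w x) := by
  refine ⟨hv.continuous.add hw.continuous, fun a b => ?_⟩
  rw [Real.circleAverage_fun_add (hv.continuous.circleIntegrable_comp_line a b)
    (hw.continuous.circleIntegrable_comp_line a b)]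
  exact add_le_add (hv.le_circleAverage a b) (hw.le_circleAverage a b)

theorem IsContPsh.const_mul {w : X → ℝ} (hw : IsContPsh w) {c : ℝ} (hc : 0 ≤ c) :
    IsContPsh (fun x => c * w x) := by
  refine ⟨continuous_const.mul hw.continuous, fun a b => ?_⟩
  have h : Real.circleAverage (fun ζ : ℂ => c * w (a + ζ • b)) 0 1
      = c * Real.circleAverage (fun ζ : ℂ => w (a + ζ • b)) 0 1 :=
    Real.circleAverage_fun_smul (a := c) (f := fun ζ : ℂ => w (a + ζ • b))
  rw [h]
  exact mul_le_mul_of_nonneg_left (hw.le_circleAverage a b) hc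

theorem IsContPsh.max {v w : X → ℝ} (hv : IsContPsh v) (hw : IsContPsh w) :
    IsContPsh (fun x => max (v x) (w x)) := by
  have hc : Continuous (fun x => Max.max (v x) (w x)) := hv.continuous.max hw.continuous
  refine ⟨hc, fun a b => max_le ?_ ?_⟩
  · exact (hv.le_circleAverage a b).trans (Real.circleAverage_mono
      (hv.continuous.circleIntegrable_comp_line a b) (hc.circleIntegrable_comp_line a b)
      fun _ _ => le_max_left _ _)
  · exact (hw.le_circleAverage a b).trans (Real.circleAverage_mono
      (hw.continuous.circleIntegrable_comp_line a b) (hc.circleIntegrable_comp_line a b)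
      fun _ _ => le_max_right _ _)

theorem IsContPsh.finset_sum {ι : Type*} {w : ι → X → ℝ} (hw : ∀ i, IsContPsh (w i))
    (s : Finset ι) : IsContPsh (fun x => ∑ i ∈ s, w i x) := by
  classical
  induction s using Finset.induction_on with
  | empty => simpa using isContPsh_const (X := X) 0
  | insert i s hi ih => simpa [Finset.sum_insert hi] using (hw i).add ih

/-- A locally finite sum of continuous plurisubharmonic functions is one: on each closed disc, which
is compact, only finitely many terms are nonzero. -/
theorem IsContPsh.finsum {ι : Type*} {w : ι → X → ℝ} (hw : ∀ i, IsContPsh (w i))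
    (hfin : LocallyFinite fun i => Function.support (w i)) :
    IsContPsh (fun x => ∑ᶠ i, w i x) := by
  refine ⟨continuous_finsum (fun i => (hw i).continuous) hfin, fun a b => ?_⟩
  have hS : IsCompact ((fun ζ : ℂ => a + ζ • b) '' Metric.closedBall 0 1) :=
    (isCompact_closedBall 0 1).image (by fun_prop)
  have hF := hfin.finite_nonempty_inter_compact hS
  have key : ∀ ζ ∈ Metric.closedBall (0 : ℂ) 1,
      ∑ᶠ i, w i (a + ζ • b) = ∑ i ∈ hF.toFinset, w i (a + ζ • b) := by
    intro ζ hζ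
    refine finsum_eq_sum_of_support_subset _ fun i hi => ?_
    simp only [Set.Finite.coe_toFinset]
    exact ⟨a + ζ • b, hi, ζ, hζ, rfl⟩
  have h0 := key 0 (by simp)
  simp only [zero_smul, add_zero] at h0
  rw [h0, Real.circleAverage_congr_sphere (f₂ := fun ζ : ℂ => ∑ i ∈ hF.toFinset, w i (a + ζ • b))]
  · exact (IsContPsh.finset_sum hw hF.toFinset).le_circleAverage a b
  · intro ζ hζ
    rw [abs_one] at hζ
    exact key ζ (Metric.sphere_subset_closedBall hζ)

/-- The sub-mean value property of `log⁺ ‖·‖` on complex affine functions of one variable. -/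
theorem posLog_norm_le_circleAverage (A B : ℂ) :
    Real.posLog ‖A‖ ≤ Real.circleAverage (fun ζ : ℂ => Real.posLog ‖A + ζ * B‖) 0 1 := by
  have hint : CircleIntegrable (fun ζ : ℂ => Real.posLog ‖A + ζ * B‖) 0 1 :=
    ContinuousOn.circleIntegrable' (by fun_prop)
  rw [Real.posLog_apply]
  refine max_le (Real.circleAverage_nonneg_of_nonneg fun _ _ => Real.posLog_nonneg) ?_
  by_cases hB : B = 0
  · simp only [hB, mul_zero, add_zero, Real.circleAverage_const]
    exact le_max_right _ _
  by_cases hA : A = 0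
  · simp only [hA, norm_zero, Real.log_zero]
    exact Real.circleAverage_nonneg_of_nonneg fun _ _ => Real.posLog_nonneg
  -- `log ‖A + ζ B‖ = log ‖B‖ + log ‖ζ + A / B‖` off the zero of the affine function.
  have hlog : CircleIntegrable (fun ζ : ℂ => Real.log ‖ζ + A / B‖) 0 1 := by
    simpa using circleIntegrable_log_norm_sub_const (c := 0) (a := -(A / B)) 1
  have hlog' : CircleIntegrable (fun ζ : ℂ => Real.log ‖A + ζ * B‖) 0 1 :=
    MeromorphicOn.circleIntegrable_log_norm (f := fun ζ : ℂ => A + ζ * B) (fun z hz => by fun_prop)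
  have h1 : Real.circleAverage (fun ζ : ℂ => Real.log ‖A + ζ * B‖) 0 1
      = Real.circleAverage (fun ζ : ℂ => Real.log ‖B‖ + Real.log ‖ζ + A / B‖) 0 1 := by
    refine Real.circleAverage_congr_codiscreteWithin ?_ one_ne_zero
    filter_upwards [compl_singleton_mem_codiscreteWithin (s := Metric.sphere (0 : ℂ) |1|)
      (-(A / B))] with ζ hζ
    have hne : ζ + A / B ≠ 0 := fun h => hζ (eq_neg_of_add_eq_zero_left h)
    rw [← Real.log_mul (norm_ne_zero_iff.2 hB) (norm_ne_zero_iff.2 hne), ← norm_mul]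
    congr 2
    field_simp
    ring
  calc Real.log ‖A‖ = Real.log ‖B‖ + Real.log ‖A / B‖ := by
        rw [← Real.log_mul (norm_ne_zero_iff.2 hB) (norm_ne_zero_iff.2 (div_ne_zero hA hB)),
          ← norm_mul, mul_div_cancel₀ _ hB]
    _ ≤ Real.log ‖B‖ + Real.posLog ‖A / B‖ := by gcongr; exact le_max_right _ _
    _ = Real.circleAverage (fun ζ : ℂ => Real.log ‖A + ζ * B‖) 0 1 := by
        rw [h1, Real.circleAverage_fun_add (by exact circleIntegrable_const _ _ _) hlog,
          Real.circleAverage_const]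
        congr 1
        exact circleAverage_log_norm_add_const_eq_posLog.symm
    _ ≤ _ := Real.circleAverage_mono hlog' hint fun _ _ => le_max_right _ _

/-- By the Hahn–Banach theorem `log⁺ ‖T x‖` is a supremum of functions `log⁺ |f x|`, with `f`
complex linear. -/
theorem isContPsh_posLog_norm (c : ℝ) (hc : 0 ≤ c) (T : X →L[ℂ] X) :
    IsContPsh (fun x => Real.posLog (c * ‖T x‖)) := by
  have hcont : Continuous (fun x => Real.posLog (c * ‖T x‖)) := by fun_prop
  refine ⟨hcont, fun a b => ?_⟩
  obtain ⟨g, hg, hga⟩ := exists_dual_vector'' ℂ (T a)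
  have hca : Real.posLog (c * ‖T a‖) = Real.posLog ‖(c : ℂ) * g (T a)‖ := by
    rw [hga]; simp [abs_of_nonneg hc]
  rw [hca]
  refine (posLog_norm_le_circleAverage _ ((c : ℂ) * g (T b))).trans
    (Real.circleAverage_mono (ContinuousOn.circleIntegrable' (by fun_prop))
      (hcont.circleIntegrable_comp_line a b) fun ζ _ => ?_)
  refine Real.posLog_le_posLog (norm_nonneg _) ?_
  have : (c : ℂ) * g (T a) + ζ * ((c : ℂ) * g (T b)) = c * g (T (a + ζ • b)) := by
    simp only [map_add, map_smul, smul_eq_mul]; ring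
  rw [this, norm_mul, Complex.norm_real, Real.norm_of_nonneg hc]
  gcongr
  exact (g.le_opNorm _).trans (mul_le_of_le_one_left (norm_nonneg _) hg)

end Plurisubharmonic

/-! ### Relative domination and gluing -/

section Domination

open Filter Topology

variable {X : Type*} [NormedAddCommGroup X]

/-- The gap `τ` used for relative domination in a space whose basis has tail projections of norm at
most `D`: it bounds `1 + log⁺ ‖T x‖` for each of these projections `T`. -/
noncomputable def gap (D : ℝ) (x : X) : ℝ := 1 + Real.posLog (D * ‖x‖)

theorem continuous_gap (D : ℝ) : Continuous (gap D : X → ℝ) := by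
  unfold gap; fun_prop

theorem one_le_gap (D : ℝ) (x : X) : 1 ≤ gap D x :=
  le_add_of_nonneg_right Real.posLog_nonneg

variable [NormedSpace ℂ X]

/-- Relative domination of `u` on `K`: for every continuous plurisubharmonic `q`, some nonnegative
continuous plurisubharmonic `w` exceeds `u` on `K ∩ {q ≥ 0}` and vanishes on `{q < -τ}`. The gap
function `τ` does not depend on `q` or on `K`; this uniformity is what allows infinitely many
dominating functions to be summed. -/
def IsDominatedOn (u τ : X → ℝ) (K : Set X) : Prop :=
  ∀ q : X → ℝ, IsContPsh q → ∃ w : X → ℝ, IsContPsh w ∧ (∀ x, 0 ≤ w x) ∧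
    (∀ x ∈ K, 0 ≤ q x → u x < w x) ∧ ∀ x, q x < -τ x → w x = 0

theorem isDominatedOn_of_le {u τ : X → ℝ} (hτ : ∀ x, 1 ≤ τ x) {K : Set X} {C : ℝ}
    (hK : ∀ x ∈ K, u x ≤ C) : IsDominatedOn u τ K := by
  intro q hq
  refine ⟨fun x => (|C| + 1) * max (q x + 1) 0,
    ((hq.add (isContPsh_const 1)).max (isContPsh_const 0)).const_mul (by positivity),
    fun x => by positivity, fun x hx hqx => ?_, fun x hx => ?_⟩
  · have h1 : 1 ≤ max (q x + 1) 0 := le_max_of_le_left (by linarith)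
    nlinarith [hK x hx, le_abs_self C, abs_nonneg C]
  · have h1 : max (q x + 1) 0 = 0 := max_eq_right (by linarith [hτ x])
    simp [h1]

/-- Gluing: if the functions `q m` tend to `-∞` locally uniformly, the functions dominating `u` on
`K m ∩ {q m ≥ 0}` have locally finite supports, and they can be summed. -/
theorem exists_dominating_of_tendsto {u τ : X → ℝ} (hτ : Continuous τ) {K : ℕ → Set X}
    (hK : ∀ m, IsDominatedOn u τ (K m)) {q : ℕ → X → ℝ} (hq : ∀ m, IsContPsh (q m))
    (hloc : ∀ (x : X) (N : ℝ), ∃ V ∈ 𝓝 x, ∀ᶠ m in atTop, ∀ y ∈ V, q m y < -N) :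
    ∃ w : X → ℝ, IsContPsh w ∧ (∀ x, 0 ≤ w x) ∧
      (∀ m, ∀ x ∈ K m, 0 ≤ q m x → u x < w x) ∧ ∀ x, (∀ m, q m x < -τ x) → w x = 0 := by
  choose w hw hw0 hwu hwz using fun m => hK m (q m) (hq m)
  have hfin : LocallyFinite fun m => Function.support (w m) := by
    intro x
    obtain ⟨V, hV, hVm⟩ := hloc x (τ x + 1)
    refine ⟨V ∩ {y | τ y < τ x + 1}, inter_mem hV
      (hτ.continuousAt.eventually_lt continuousAt_const (by simp)), ?_⟩
    obtain ⟨M, hM⟩ := eventually_atTop.1 hVm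
    refine (Set.finite_lt_nat M).subset ?_
    rintro m ⟨y, hy, hyV, hyτ⟩
    by_contra hm
    exact hy (hwz m y ((hM m (not_lt.1 hm) y hyV).trans
      (neg_lt_neg (show τ y < τ x + 1 from hyτ))))
  refine ⟨fun x => ∑ᶠ m, w m x, IsContPsh.finsum hw hfin,
    fun x => finsum_nonneg fun m => hw0 m x, fun m x hx hqx => ?_, fun x hx => ?_⟩
  · exact (hwu m x hx hqx).trans_le
      (single_le_finsum m (hfin.point_finite x) fun m => hw0 m x)
  · simp [hwz _ x (hx _)]

theorem posLog_natCast_mul_sub_log_le (m : ℕ) {s : ℝ} :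
    Real.posLog (m * s) - Real.log m ≤ Real.posLog s := by
  linarith [Real.posLog_nat_mul (n := m) (x := s)]

/-- If `s ≤ exp (-N)` then `log⁺ (m s) - log m = log max (1 / m) s ≤ -N` for large `m`. -/
theorem eventually_posLog_natCast_mul_sub_log_le (N : ℝ) : ∀ᶠ m : ℕ in atTop,
    ∀ s : ℝ, 0 ≤ s → s ≤ Real.exp (-N) → Real.posLog (m * s) - Real.log m ≤ -N := by
  filter_upwards [(tendsto_natCast_atTop_atTop (R := ℝ)).eventually_ge_atTop (Real.exp N),
    eventually_gt_atTop 0] with m hm hm0 s hs0 hs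
  have hm0' : (0 : ℝ) < m := by exact_mod_cast hm0
  have h1 : (1 : ℝ) ≤ m * Real.exp (-N) := by
    rw [Real.exp_neg, ← div_eq_mul_inv, one_le_div (Real.exp_pos N)]
    exact hm
  rw [Real.posLog_eq_log_max_one (by positivity), sub_le_iff_le_add]
  calc Real.log (max 1 (m * s)) ≤ Real.log (m * Real.exp (-N)) := by
        refine Real.log_le_log (by positivity) (max_le h1 ?_)
        gcongr
    _ = -N + Real.log m := by
        rw [Real.log_mul hm0'.ne' (Real.exp_pos _).ne', Real.log_exp, add_comm]

/-- If `T m → 0` pointwise, with `‖T m‖ ≤ D`, then relative domination of `u` on all sets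
`K ∩ {‖T m x‖ ≤ ε}` implies relative domination on `K`: a point of `K` at which `m` is the first
index with `‖T m x‖ ≤ ε` is detected by `log (‖T (m - 1) x‖ / ε) ≥ 0`, and truncating this logarithm
at `-log m` gives continuous functions that tend to `-∞` locally uniformly. -/
theorem IsDominatedOn.of_forall_inter {u : X → ℝ} {T : ℕ → X →L[ℂ] X} {D : ℝ}
    (hD : ∀ m x, ‖T m x‖ ≤ D * ‖x‖) (hT : ∀ x, Tendsto (fun m => T m x) atTop (𝓝 0))
    {ε : ℝ} (hε : 0 < ε) (hε1 : ε ≤ 1) {K : Set X}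
    (hK : ∀ m, IsDominatedOn u (gap D) (K ∩ {x | ‖T m x‖ ≤ ε})) :
    IsDominatedOn u (gap D) K := by
  intro p hp
  have hεinv : 0 ≤ Real.log ε⁻¹ := Real.log_nonneg ((one_le_inv₀ hε).2 hε1)
  -- The factor `α` makes `{p < -τ}` small enough to absorb the growth of `log⁺ ‖T m x‖`.
  set α : ℝ := 2 + Real.log ε⁻¹ with hα
  -- For `m = 0` the second summand is `log⁺ 0 - log 0 = 0`.
  set q : ℕ → X → ℝ := fun m x =>
    α * p x + (Real.posLog (m * ε⁻¹ * ‖T (m - 1) x‖) + -Real.log m) with hq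
  have hqpsh : ∀ m, IsContPsh (q m) := fun m =>
    (hp.const_mul (by positivity)).add
      ((isContPsh_posLog_norm _ (by positivity) _).add (isContPsh_const _))
  have hloc : ∀ (x : X) (N : ℝ), ∃ V ∈ 𝓝 x, ∀ᶠ m in atTop, ∀ y ∈ V, q m y < -N := by
    intro x N
    set N' : ℝ := N + (α * p x + 1)
    set η : ℝ := ε * Real.exp (-N')
    have hη : 0 < η := by positivity
    have hV : ∀ᶠ y in 𝓝 x, α * p y < α * p x + 1 ∧ D * ‖y - x‖ < η / 2 :=
      ((continuous_const.mul hp.continuous).continuousAt.eventually_lt continuousAt_const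
        (lt_add_one _)).and (ContinuousAt.eventually_lt (by fun_prop) continuousAt_const
          (by simpa using hη))
    refine ⟨_, hV, ?_⟩
    have hTx : ∀ᶠ m in atTop, ‖T (m - 1) x‖ < η / 2 :=
      ((hT x).norm.comp (tendsto_sub_atTop_nat 1)).eventually_lt_const (by simpa using hη)
    filter_upwards [hTx, eventually_posLog_natCast_mul_sub_log_le N'] with m hm hm' y hy
    have hTy : ‖T (m - 1) y‖ ≤ η := by
      have h1 : T (m - 1) y = T (m - 1) x + T (m - 1) (y - x) := by rw [map_sub]; abel
      rw [h1]
      linarith [norm_add_le (T (m - 1) x) (T (m - 1) (y - x)), hD (m - 1) (y - x), hy.2]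
    have h2 := hm' (ε⁻¹ * ‖T (m - 1) y‖) (by positivity) (by
      rw [inv_mul_le_iff₀ hε]; exact hTy)
    rw [← mul_assoc] at h2
    have h3 := hy.1
    simp only [hq]
    linarith
  obtain ⟨w, hw, hw0, hwu, hwz⟩ := exists_dominating_of_tendsto (continuous_gap D) hK hqpsh hloc
  refine ⟨w, hw, hw0, fun x hx hpx => ?_, fun x hpx => hwz x fun m => ?_⟩
  · have hex : ∃ m, ‖T m x‖ ≤ ε :=
      (((hT x).norm.eventually_lt_const (by simpa using hε)).mono fun _ h => h.le).exists
    classical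
    refine hwu (Nat.find hex) x ⟨hx, Nat.find_spec hex⟩ (add_nonneg (by positivity) ?_)
    rcases Nat.eq_zero_or_pos (Nat.find hex) with h0 | hpos
    · simp [h0]
    · have hgt : ε < ‖T (Nat.find hex - 1) x‖ :=
        not_le.1 (Nat.find_min hex (Nat.sub_lt hpos one_pos))
      set m := Nat.find hex
      have hm1 : (1 : ℝ) ≤ m := by exact_mod_cast hpos
      have hle : (m : ℝ) ≤ m * ε⁻¹ * ‖T (m - 1) x‖ := by
        rw [mul_assoc]
        refine le_mul_of_one_le_right (by positivity) ?_
        rw [← div_eq_inv_mul, one_le_div hε]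
        exact hgt.le
      have := Real.log_le_log (by positivity) hle
      have h2 : Real.log (m * ε⁻¹ * ‖T (m - 1) x‖) ≤ Real.posLog (m * ε⁻¹ * ‖T (m - 1) x‖) :=
        le_max_right _ _
      linarith
  · have h1 := posLog_natCast_mul_sub_log_le m (s := ε⁻¹ * ‖T (m - 1) x‖)
    have h2 : Real.posLog (ε⁻¹ * ‖T (m - 1) x‖) ≤ Real.log ε⁻¹ + Real.posLog (D * ‖x‖) := by
      refine Real.posLog_mul.trans (add_le_add (le_of_eq ?_)
        (Real.posLog_le_posLog (norm_nonneg _) (hD _ _)))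
      rw [Real.posLog_eq_log]
      rw [abs_of_pos (by positivity)]
      exact (one_le_inv₀ hε).2 hε1
    rw [← mul_assoc] at h1
    have h3 : 0 ≤ Real.posLog (D * ‖x‖) := Real.posLog_nonneg
    have h4 : p x < -(1 + Real.posLog (D * ‖x‖)) := hpx
    have h5 : α * p x < α * -(1 + Real.posLog (D * ‖x‖)) := by gcongr
    simp only [hq, gap]
    nlinarith [mul_nonneg hεinv h3]

end Domination

/-! ### Bounded sets in a space with a Schauder basis -/

section SchauderBasis

open Filter Topology

variable {X : Type*} [NormedAddCommGroup X] [NormedSpace ℂ X]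

/-- The image of a bounded set under a projection of a Schauder basis is totally bounded, since it
is a bounded subset of a finite-dimensional space. -/
theorem SchauderBasis.totallyBounded_image_proj (b : SchauderBasis ℂ X) (n : ℕ) (R : ℝ) :
    TotallyBounded (SchauderBasis.proj b n '' Metric.closedBall 0 R) := by
  have hfd : FiniteDimensional ℂ (SchauderBasis.proj b n).toLinearMap.range := by
    rw [SchauderBasis.range_proj_eq_span]
    exact FiniteDimensional.span_of_finite ℂ ((Finset.range n).finite_toSet.image _)
  have : ProperSpace (SchauderBasis.proj b n).toLinearMap.range := FiniteDimensional.proper ℂ _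
  refine ((isCompact_closedBall (0 : (SchauderBasis.proj b n).toLinearMap.range)
    (‖SchauderBasis.proj b n‖ * R)).image continuous_subtype_val).totallyBounded.subset ?_
  rintro _ ⟨x, hx, rfl⟩
  refine ⟨⟨SchauderBasis.proj b n x, x, rfl⟩, ?_, rfl⟩
  rw [mem_closedBall_zero_iff] at hx ⊢
  exact (SchauderBasis.proj b n).le_opNorm_of_le hx

/-- A bounded sequence that is eventually within any given distance of its image under some basis
projection has a cluster point. -/
theorem SchauderBasis.exists_mapClusterPt [CompleteSpace X] (b : SchauderBasis ℂ X) {R : ℝ}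
    {x : ℕ → X} (hx : ∀ i, ‖x i‖ ≤ R)
    (htail : ∀ ε > 0, ∃ n, ∀ᶠ i in atTop, ‖x i - SchauderBasis.proj b n (x i)‖ ≤ ε) :
    ∃ y, MapClusterPt y atTop x := by
  have htb : TotallyBounded (Set.range x) := by
    rw [Metric.totallyBounded_iff]
    intro ε hε
    obtain ⟨n, hn⟩ := htail (ε / 2) (by positivity)
    obtain ⟨M, hM⟩ := eventually_atTop.1 hn
    obtain ⟨t, ht, htc⟩ := Metric.totallyBounded_iff.1
      (SchauderBasis.totallyBounded_image_proj b n R) (ε / 2) (by positivity)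
    refine ⟨t ∪ x '' {i | i < M}, ht.union ((Set.finite_lt_nat M).image x), ?_⟩
    rintro _ ⟨i, rfl⟩
    rw [Set.mem_iUnion₂]
    rcases lt_or_ge i M with hi | hi
    · exact ⟨x i, Or.inr ⟨i, hi, rfl⟩, Metric.mem_ball_self hε⟩
    · obtain ⟨y, hy, hyb⟩ := Set.mem_iUnion₂.1
        (htc ⟨x i, mem_closedBall_zero_iff.2 (hx i), rfl⟩)
      refine ⟨y, Or.inl hy, ?_⟩
      have h1 := hM i hi
      rw [← dist_eq_norm] at h1
      rw [Metric.mem_ball] at hyb ⊢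
      linarith [dist_triangle (x i) (SchauderBasis.proj b n (x i)) y]
  have hc : IsCompact (closure (Set.range x)) := htb.closure.isCompact_of_isClosed isClosed_closure
  obtain ⟨y, -, hy⟩ := hc.exists_mapClusterPt_of_frequently
    (Frequently.of_forall (f := atTop) fun i => subset_closure (Set.mem_range_self i))
  exact ⟨y, hy⟩

/-- If relative domination failed on a ball, it would fail on a decreasing sequence of sets cut out
of the ball by tail conditions `‖x - proj n x‖ ≤ ε` with `ε → 0`; then `u` is unbounded on each of
them, and points with large values of `u` cluster, contradicting local boundedness. -/
theorem SchauderBasis.isDominatedOn_closedBall [CompleteSpace X] (b : SchauderBasis ℂ X)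
    {u : X → ℝ} (hu : IsLocallyBounded u) {D : ℝ}
    (hD : ∀ m x, ‖x - SchauderBasis.proj b m x‖ ≤ D * ‖x‖) (R : ℝ) :
    IsDominatedOn u (gap D) (Metric.closedBall (0 : X) R) := by
  by_contra hR
  set ε : ℕ → ℝ := fun j => 1 / ((j : ℝ) + 1)
  have hε : ∀ j, 0 < ε j := fun j => Nat.one_div_pos_of_nat
  have hε1 : ∀ j, ε j ≤ 1 := fun j => by
    simpa [ε] using Nat.one_div_le_one_div (α := ℝ) (Nat.zero_le j)
  have hstep : ∀ (j : ℕ) (K : {K : Set X // ¬ IsDominatedOn u (gap D) K}), ∃ m,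
      ¬ IsDominatedOn u (gap D) (K.1 ∩ {x | ‖x - SchauderBasis.proj b m x‖ ≤ ε j}) := by
    intro j K
    by_contra! h
    refine K.2 (IsDominatedOn.of_forall_inter
      (T := fun m => ContinuousLinearMap.id ℂ X - SchauderBasis.proj b m) (by simpa using hD)
      (fun x => ?_) (hε j) (hε1 j) (by simpa using h))
    simpa using (tendsto_const_nhds (x := x)).sub (SchauderBasis.tendsto_proj b x)
  choose m hm using hstep
  let K : ℕ → {K : Set X // ¬ IsDominatedOn u (gap D) K} := fun j =>
    Nat.rec ⟨_, hR⟩ (fun j K => ⟨_, hm j K⟩) j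
  have hKsucc : ∀ j, (K (j + 1)).1 = (K j).1 ∩
      {x | ‖x - SchauderBasis.proj b (m j (K j)) x‖ ≤ ε j} := fun _ => rfl
  have hanti : Antitone fun j => (K j).1 :=
    antitone_nat_of_succ_le fun j => by rw [hKsucc]; exact Set.inter_subset_left
  have hunb : ∀ j : ℕ, ∃ x ∈ (K j).1, (j : ℝ) < u x := by
    intro j
    by_contra! h
    exact (K j).2 (isDominatedOn_of_le (one_le_gap D) h)
  choose x hxK hxu using hunb
  obtain ⟨y, hy⟩ := SchauderBasis.exists_mapClusterPt b (R := R) (x := x)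
    (fun i => mem_closedBall_zero_iff.1 (hanti (Nat.zero_le i) (hxK i))) (fun δ hδ => by
      obtain ⟨j, hj⟩ := exists_nat_one_div_lt hδ
      refine ⟨m j (K j), eventually_atTop.2 ⟨j + 1, fun i hi => ?_⟩⟩
      have h1 : x i ∈ (K (j + 1)).1 := hanti hi (hxK i)
      rw [hKsucc] at h1
      exact h1.2.trans hj.le)
  obtain ⟨V, hV, C, hC⟩ := hu y
  obtain ⟨i, hiV, hi⟩ := ((hy.frequently hV).and_eventually
    ((tendsto_natCast_atTop_atTop (R := ℝ)).eventually_ge_atTop C)).exists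
  linarith [hxu i, hC _ hiV, le_abs_self (u (x i))]

end SchauderBasis

open Filter Topology in
theorem proposition3p1 {X : Type*} [NormedAddCommGroup X] [NormedSpace ℂ X] [CompleteSpace X]
    (hX : Nonempty (SchauderBasis ℂ X)) (u : X → ℝ) (hu : IsLocallyBounded u) :
    ∃ w ∈ psc (Set.univ : Set X), ∀ x : X, u x < w x := by
  obtain ⟨b⟩ := hX
  obtain ⟨C, hC⟩ := SchauderBasis.exists_norm_proj_le b
  have hD : ∀ m x, ‖x - SchauderBasis.proj b m x‖ ≤ (1 + C) * ‖x‖ := fun m x => by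
    have h1 := ContinuousLinearMap.le_of_opNorm_le _ (hC m) x
    linarith [norm_sub_le x (SchauderBasis.proj b m x)]
  -- The functions `log⁺ ‖x‖ - log n` are nonnegative where `n < ‖x‖ ≤ n + 1` and tend to `-∞`
  -- locally uniformly; for `n = 0` the junk value `log 0 = 0` gives a nonnegative function.
  obtain ⟨w, hw, -, hwu, -⟩ := exists_dominating_of_tendsto (u := u) (continuous_gap (1 + C))
    (K := fun n : ℕ => Metric.closedBall (0 : X) (n + 1))
    (fun n => SchauderBasis.isDominatedOn_closedBall b hu hD _)
    (q := fun n x => Real.posLog (1 * ‖ContinuousLinearMap.id ℂ X x‖) + -Real.log n)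
    (fun n => (isContPsh_posLog_norm 1 zero_le_one _).add (isContPsh_const _)) (by
      intro x N
      have hcont : Continuous fun y : X => Real.posLog ‖y‖ := by fun_prop
      refine ⟨_, hcont.continuousAt.eventually_lt
        (continuousAt_const (y := Real.posLog ‖x‖ + 1)) (lt_add_one _), ?_⟩
      filter_upwards [(Real.tendsto_log_atTop.comp
        (tendsto_natCast_atTop_atTop (R := ℝ))).eventually_ge_atTop
          (N + (Real.posLog ‖x‖ + 1))] with n hn y hy
      have hy' : Real.posLog ‖y‖ < Real.posLog ‖x‖ + 1 := hy
      simp only [Function.comp_apply] at hn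
      simp only [one_mul, ContinuousLinearMap.id_apply]
      linarith)
  refine ⟨w, hw.mem_psc, fun x => ?_⟩
  have hceil : ∃ n : ℕ, ‖x‖ ≤ n + 1 := (exists_nat_ge ‖x‖).imp fun n hn => by linarith
  classical
  refine hwu (Nat.find hceil) x (mem_closedBall_zero_iff.2 (Nat.find_spec hceil)) ?_
  rcases Nat.eq_zero_or_pos (Nat.find hceil) with h0 | hpos
  · simp [h0, Real.posLog_nonneg]
  · have hgt := not_le.1 (Nat.find_min hceil (Nat.sub_lt hpos one_pos))
    rw [Nat.cast_sub (Nat.one_le_iff_ne_zero.2 hpos.ne'), Nat.cast_one, sub_add_cancel] at hgt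
    have h1 := Real.log_le_log (by exact_mod_cast hpos) hgt.le
    have h2 : Real.log ‖x‖ ≤ Real.posLog ‖x‖ := le_max_right _ _
    simp only [one_mul, ContinuousLinearMap.id_apply]
    linarith
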